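/- **Theorem 3.5.** Let $[n]=\{1,\dots,n\}$ and let $f:2^{[n]}\to\mathbb Z$ satisfy $f(\emptyset)=0$ and $f(I)+f(J)\ge f(I\cup J)+f(I\cap J)$ for all $I,J\subseteq[n]$. Let $$P=\Big\{a\in\mathbb Z^{n}\ \Big|\ \sum_{i\in I}a_i\le f(I)\text{ for all }I\subseteq[n],\ \sum_{i\in[n]}a_i=f([n])\Big\}$$ be the polymatroid on $[n]$ with rank function $f$. For a finite totally ordered set $E$, a finite set $Q\subset\mathbb Z^{E}$ and $a\in Q$, let $e_i$ $(i\in E)$ be the standard unit vectors and let $$\mathrm{Int}_Q(a)=\{i\in E\mid a-e_i+e_j\notin Q\text{ for all }j<i\},\qquad \mathrm{Ext}_Q(a)=\{i\in E\mid a+e_i-e_j\notin Q\text{ for all }j<i\}$$ be the sets of internally and externally active indices, and let $$\mathscr T_Q(x,y)=\sum_{a\in Q}x^{|\mathrm{Int}_Q(a)\setminus\mathrm{Ext}_Q(a)|}\,y^{|\mathrm{Ext}_Q(a)\setminus\mathrm{Int}_Q(a)|}\,(x+y-1)^{|\mathrm{Int}_Q(a)\cap\mathrm{Ext}_Q(a)|}\in\mathbb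 Z[x,y].$$ If $Q$ is a polymatroid, this is its polymatroid Tutte polynomial. Let $t\in[n]$, $\alpha_t=f([n])-f([n]\setminus\{t\})$ and $\beta_t=f(\{t\})$. For an integer $j$ with $\alpha_t\le j\le\beta_t$ let $$\widehat P^{t}_{j}=\{(a_1,\dots,a_{t-1},a_{t+1},\dots,a_n)\mid (a_1,\dots,a_n)\in P,\ a_t=j\}\subset\mathbb Z^{[n]\setminus\{t\}},$$ where $[n]\setminus\{t\}$ has the order induced from $[n]$. If $\beta_t-\alpha_t>0$, then $$\mathscr T_P(x,y)=x\,\mathscr T_{\widehat P^{t}_{\alpha_t}}(x,y)+y\,\mathscr T_{\widehat P^{t}_{\beta_t}}(x,y)+\sum_{\alpha_t<j<\beta_t}\mathscr T_{\widehat P^{t}_{j}}(x,y).$$ -/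

import Mathlib

namespace Polymatroid

/-- `P ⊆ ℤ^ι` is the polymatroid (the set of integer bases) with rank function `f`:
`f` is an integer-valued submodular set function with `f ∅ = 0` (not assumed monotone or
nonnegative), and `P` consists of the integer vectors `a` with `∑_{i ∈ I} a i ≤ f I` for all `I`
and with equality for the whole ground set. -/
structure IsPolymatroid {ι : Type*} [Fintype ι] [DecidableEq ι]
    (P : Set (ι → ℤ)) (f : Finset ι → ℤ) : Prop where
  map_empty : f ∅ = 0
  submodular : ∀ I J : Finset ι, f (I ∪ J) + f (I ∩ J) ≤ f I + f J
  eq_bases : P = {a : ι → ℤ | (∀ I : Finset ι, ∑ i ∈ I, a i ≤ f I) ∧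
    ∑ i, a i = f Finset.univ}

/-- The indices that are internally active for `a`. -/
def intActive {ι : Type*} [LinearOrder ι] (P : Set (ι → ℤ)) (a : ι → ℤ) : Set ι :=
  {i | ∀ j, j < i → a - Pi.single i 1 + Pi.single j 1 ∉ P}

/-- The indices that are externally active for `a`. -/
def extActive {ι : Type*} [LinearOrder ι] (P : Set (ι → ℤ)) (a : ι → ℤ) : Set ι :=
  {i | ∀ j, j < i → a + Pi.single i 1 - Pi.single j 1 ∉ P}

/-- The polymatroid Tutte polynomial, with `x = X 0` and `y = X 1`, of a finite set
`P ⊆ ℤ^ι` over a finite totally ordered ground set `ι`. -/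
noncomputable def tutte {ι : Type*} [LinearOrder ι] (P : Set (ι → ℤ)) :
    MvPolynomial (Fin 2) ℤ :=
  ∑ᶠ a ∈ P,
    (MvPolynomial.X 0) ^ (intActive P a \ extActive P a).ncard *
    (MvPolynomial.X 1) ^ (extActive P a \ intActive P a).ncard *
    (MvPolynomial.X 0 + MvPolynomial.X 1 - 1) ^ (intActive P a ∩ extActive P a).ncard

/-- The slice of `P` on which the coordinate `t` equals `j`. -/
def slice {ι : Type*} (P : Set (ι → ℤ)) (t : ι) (j : ℤ) : Set (ι → ℤ) :=
  {a | a ∈ P ∧ a t = j}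

/-- The projected slice: the coordinate `t` is forgotten, and the remaining ground set
`ι ∖ {t}` carries the induced order. -/
def projSlice {ι : Type*} (P : Set (ι → ℤ)) (t : ι) (j : ℤ) : Set ({i : ι // i ≠ t} → ℤ) :=
  (fun a i => a i) '' slice P t j

/-- `α_t = f(E) - f(E ∖ {t})`, where `E` is the ground set. -/
def alpha {ι : Type*} [Fintype ι] [DecidableEq ι] (f : Finset ι → ℤ) (t : ι) : ℤ :=
  f Finset.univ - f (Finset.univ \ {t})

/-- `β_t = f({t})`. -/
def beta {ι : Type*} (f : Finset ι → ℤ) (t : ι) : ℤ :=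
  f {t}

/-- A polymatroid is a finite set, so the sum in `tutte` is a genuine finite sum. -/
theorem IsPolymatroid.finite {ι : Type*} [Fintype ι] [DecidableEq ι]
    {P : Set (ι → ℤ)} {f : Finset ι → ℤ} (h : IsPolymatroid P f) : P.Finite := by
  refine (Set.finite_Icc (fun i => alpha f i) (fun i => beta f i)).subset ?_
  intro a ha
  rw [h.eq_bases] at ha
  obtain ⟨h1, h2⟩ := ha
  refine ⟨fun i => ?_, fun i => ?_⟩
  · have h3 := h1 (Finset.univ \ {i})
    have h4 : ∑ k ∈ Finset.univ \ {i}, a k + ∑ k ∈ ({i} : Finset ι), a k = ∑ k, a k :=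
      Finset.sum_sdiff (Finset.subset_univ _)
    simp only [Finset.sum_singleton] at h4
    simp only [alpha]
    linarith
  · simpa [beta] using h1 {i}

theorem IsPolymatroid.finite_projSlice {ι : Type*} [Fintype ι] [DecidableEq ι]
    {P : Set (ι → ℤ)} {f : Finset ι → ℤ} (h : IsPolymatroid P f) (t : ι) (j : ℤ) :
    (projSlice P t j).Finite :=
  (h.finite.subset fun _ ha => ha.1).image _

end Polymatroid

namespace Polymatroid

variable {ι : Type*} [Fintype ι] [LinearOrder ι]

/-! The definition of `tutte` depends on the order, and the recursion is evident only for the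
largest index. The remedy is an order-free generating function: for `0 < u, v < 1`, sum `u ^ d₊(c) *
v ^ d₋(c)` over all `c ∈ ℤ^ι`, where `d₊(c)` and `d₋(c)` are the least values over `a ∈ P` of `∑ (c
i - a i)⁺` and `∑ (c i - a i)⁻`. By exchange, each minimum is attained at some `a` with `a t` the
point of `[α, β]` nearest to `c t`, for any `t`. Summing over `c t` then gives geometric series, and
the function satisfies the desired recursion in every `t` (`IsExchange.hasSum_distTerm`) with `x =
1/(1-v)`, `y = 1/(1-u)`. For the largest `t`, `tutte` satisfies the same recursion, so induction on
the ground set identifies the two (`IsExchange.hasSum_distTerm_aeval_tutte`). The recursion for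
arbitrary `t` thus holds at all real `x, y > 1`, hence as polynomials. -/

/-- The exchange property of integral base polytopes: a coordinate of `a` can be moved one step
towards another point `b`, compensated by a coordinate that also moves towards `b`. -/
structure IsExchange {ι : Type*} [LinearOrder ι] (P : Set (ι → ℤ)) : Prop where
  down : ∀ a ∈ P, ∀ b ∈ P, ∀ i, b i < a i →
    ∃ j, a j < b j ∧ a - Pi.single i 1 + Pi.single j 1 ∈ P
  up : ∀ a ∈ P, ∀ b ∈ P, ∀ i, a i < b i →
    ∃ j, b j < a j ∧ a + Pi.single i 1 - Pi.single j 1 ∈ P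

/-! ### Tight sets and the exchange property -/

namespace IsPolymatroid

variable {P : Set (ι → ℤ)} {f : Finset ι → ℤ}

theorem sum_le (h : IsPolymatroid P f) {a : ι → ℤ} (ha : a ∈ P) (I : Finset ι) :
    ∑ i ∈ I, a i ≤ f I := by
  rw [h.eq_bases] at ha
  exact ha.1 I

theorem sum_univ (h : IsPolymatroid P f) {a : ι → ℤ} (ha : a ∈ P) :
    ∑ i, a i = f Finset.univ := by
  rw [h.eq_bases] at ha
  exact ha.2

theorem exists_tight_of_notMem (h : IsPolymatroid P f) {a : ι → ℤ} (ha : a ∈ P) {i j : ι}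
    (hij : a - Pi.single i 1 + Pi.single j 1 ∉ P) :
    ∃ S : Finset ι, j ∈ S ∧ i ∉ S ∧ ∑ k ∈ S, a k = f S := by
  have key : ∀ I : Finset ι, ∑ k ∈ I, (a - Pi.single i 1 + Pi.single j 1 : ι → ℤ) k =
      ∑ k ∈ I, a k - (if i ∈ I then 1 else 0) + (if j ∈ I then 1 else 0) := by
    intro I
    simp [Finset.sum_add_distrib, Finset.sum_sub_distrib]
  by_contra hS
  push Not at hS
  apply hij
  rw [h.eq_bases]
  refine ⟨fun I => ?_, ?_⟩
  · rw [key]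
    have h1 := h.sum_le ha I
    by_cases hi : i ∈ I <;> by_cases hj : j ∈ I <;> simp only [hi, hj, if_true, if_false]
    · linarith
    · linarith
    · have := lt_of_le_of_ne h1 (hS I hj hi)
      omega
    · linarith
  · rw [key]
    simpa using h.sum_univ ha

theorem tight_union_inter (h : IsPolymatroid P f) {a : ι → ℤ} (ha : a ∈ P) {S T : Finset ι}
    (hS : ∑ k ∈ S, a k = f S) (hT : ∑ k ∈ T, a k = f T) :
    ∑ k ∈ S ∪ T, a k = f (S ∪ T) ∧ ∑ k ∈ S ∩ T, a k = f (S ∩ T) := by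
  have h1 := h.submodular S T
  have h2 := Finset.sum_union_inter (s₁ := S) (s₂ := T) (f := a)
  have h3 := h.sum_le ha (S ∪ T)
  have h4 := h.sum_le ha (S ∩ T)
  constructor <;> linarith

/-- Each blocked exchange is witnessed by a tight set, and tight sets are closed under union, so one
set witnesses them all. -/
theorem exists_tight_superset (h : IsPolymatroid P f) {a : ι → ℤ} (ha : a ∈ P) (i : ι)
    (T : Finset ι) (hT : ∀ j ∈ T, a - Pi.single i 1 + Pi.single j 1 ∉ P) :
    ∃ S : Finset ι, T ⊆ S ∧ i ∉ S ∧ ∑ k ∈ S, a k = f S := by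
  induction T using Finset.induction_on with
  | empty => exact ⟨∅, by simp, by simp, by simp [h.map_empty]⟩
  | insert j T _ ih =>
    obtain ⟨S, hTS, hiS, hS⟩ := ih fun k hk => hT k (Finset.mem_insert_of_mem hk)
    obtain ⟨S', hjS, hiS', hS'⟩ := h.exists_tight_of_notMem ha (hT j (Finset.mem_insert_self _ _))
    refine ⟨S' ∪ S, ?_, by simp [hiS, hiS'], (h.tight_union_inter ha hS' hS).1⟩
    exact Finset.insert_subset (Finset.mem_union_left _ hjS)
      (hTS.trans Finset.subset_union_right)

/-- Dual argument by intersections, starting from the whole ground set, which is always tight. -/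
theorem exists_tight_disjoint (h : IsPolymatroid P f) {a : ι → ℤ} (ha : a ∈ P) (i : ι)
    (T : Finset ι) (hT : ∀ j ∈ T, a + Pi.single i 1 - Pi.single j 1 ∉ P) :
    ∃ S : Finset ι, (∀ j ∈ T, j ∉ S) ∧ i ∈ S ∧ ∑ k ∈ S, a k = f S := by
  induction T using Finset.induction_on with
  | empty => exact ⟨Finset.univ, by simp, by simp, h.sum_univ ha⟩
  | insert j T _ ih =>
    obtain ⟨S, hTS, hiS, hS⟩ := ih fun k hk => hT k (Finset.mem_insert_of_mem hk)
    have hj := hT j (Finset.mem_insert_self _ _)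
    rw [add_sub_right_comm] at hj
    obtain ⟨S', hiS', hjS, hS'⟩ := h.exists_tight_of_notMem ha hj
    refine ⟨S' ∩ S, ?_, by simp [hiS, hiS'], (h.tight_union_inter ha hS' hS).2⟩
    intro k hk
    rcases Finset.mem_insert.1 hk with rfl | hk
    · simp [hjS]
    · simp [hTS k hk]

theorem isExchange (h : IsPolymatroid P f) : IsExchange P where
  down a ha b hb i hi := by
    by_contra! hne
    obtain ⟨S, hTS, hiS, hS⟩ := h.exists_tight_superset ha i
      (Finset.univ.filter fun j => a j < b j) fun j hj => hne j (by simpa using hj)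
    have h1 : ∑ k ∈ Sᶜ, b k < ∑ k ∈ Sᶜ, a k := by
      refine Finset.sum_lt_sum (fun k hk => ?_) ⟨i, by simpa using hiS, hi⟩
      by_contra! hk'
      exact Finset.mem_compl.1 hk (hTS (by simpa using hk'))
    have h2 := Finset.sum_add_sum_compl S a
    have h3 := Finset.sum_add_sum_compl S b
    have h4 := h.sum_le hb S
    have h5 := h.sum_univ ha
    have h6 := h.sum_univ hb
    linarith
  up a ha b hb i hi := by
    by_contra! hne
    obtain ⟨S, hTS, hiS, hS⟩ := h.exists_tight_disjoint ha i
      (Finset.univ.filter fun j => b j < a j) fun j hj => hne j (by simpa using hj)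
    have h1 : ∑ k ∈ S, a k < ∑ k ∈ S, b k := by
      refine Finset.sum_lt_sum (fun k hk => ?_) ⟨i, hiS, hi⟩
      by_contra! hk'
      exact hTS k (by simpa using hk') hk
    have h4 := h.sum_le hb S
    linarith

theorem le_beta (h : IsPolymatroid P f) (t : ι) {a : ι → ℤ} (ha : a ∈ P) : a t ≤ beta f t := by
  simpa [beta] using h.sum_le ha {t}

theorem alpha_le (h : IsPolymatroid P f) (t : ι) {a : ι → ℤ} (ha : a ∈ P) : alpha f t ≤ a t := by
  have h3 := h.sum_le ha (Finset.univ \ {t})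
  have h4 : ∑ k ∈ Finset.univ \ {t}, a k + ∑ k ∈ ({t} : Finset ι), a k = ∑ k, a k :=
    Finset.sum_sdiff (Finset.subset_univ _)
  have h5 := h.sum_univ ha
  simp only [Finset.sum_singleton] at h4
  simp only [alpha]
  linarith

theorem exists_eq_alpha (h : IsPolymatroid P f) (hne : P.Nonempty) (t : ι) :
    ∃ a ∈ P, a t = alpha f t := by
  obtain ⟨a, ha, hmin⟩ := h.finite.exists_minimalFor (fun a => a t) P hne
  refine ⟨a, ha, ?_⟩
  obtain ⟨S, hTS, htS, hS⟩ := h.exists_tight_superset ha t (Finset.univ \ {t}) fun j hj hm => by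
    have hjt : t ≠ j := by simpa [eq_comm] using hj
    have := hmin hm (by simp [hjt])
    simp [hjt] at this
  have hSeq : S = Finset.univ \ {t} := by
    refine Finset.Subset.antisymm (fun k hk => ?_) hTS
    simp only [Finset.mem_sdiff, Finset.mem_univ, true_and, Finset.mem_singleton]
    rintro rfl
    exact htS hk
  have h4 : ∑ k ∈ Finset.univ \ {t}, a k + ∑ k ∈ ({t} : Finset ι), a k = ∑ k, a k :=
    Finset.sum_sdiff (Finset.subset_univ _)
  have h5 := h.sum_univ ha
  rw [hSeq] at hS
  simp only [Finset.sum_singleton] at h4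
  simp only [alpha]
  linarith

theorem exists_eq_beta (h : IsPolymatroid P f) (hne : P.Nonempty) (t : ι) :
    ∃ a ∈ P, a t = beta f t := by
  obtain ⟨a, ha, hmax⟩ := h.finite.exists_maximalFor (fun a => a t) P hne
  refine ⟨a, ha, ?_⟩
  obtain ⟨S, hTS, htS, hS⟩ := h.exists_tight_disjoint ha t (Finset.univ \ {t}) fun j hj hm => by
    have hjt : t ≠ j := by simpa [eq_comm] using hj
    have := hmax hm (by simp [hjt])
    simp [hjt] at this
  have hSeq : S = {t} := by
    refine Finset.Subset.antisymm (fun k hk => ?_) (by simpa using htS)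
    by_contra hkt
    exact hTS k (by simpa using hkt) hk
  rw [hSeq] at hS
  simpa [beta] using hS

end IsPolymatroid

/-! ### Distance to `P` and its splitting along a coordinate -/

/-- A cost `g` for which moving two coordinates, the first one towards zero, never costs more. -/
structure IsStepCost (g : ℤ → ℕ) : Prop where
  pos : ∀ z w, 0 < z → g (z - 1) + g (w + 1) ≤ g z + g w
  neg : ∀ z w, z < 0 → g (z + 1) + g (w - 1) ≤ g z + g w

theorem isStepCost_toNat : IsStepCost Int.toNat where
  pos z w h := by omega
  neg z w h := by omega

theorem isStepCost_toNat_neg : IsStepCost fun z => (-z).toNat where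
  pos z w h := by omega
  neg z w h := by omega

/-- The least cost of moving from a point of `P` to `c`. -/
noncomputable def dist (g : ℤ → ℕ) {ι : Type*} [Fintype ι] (P : Set (ι → ℤ)) (c : ι → ℤ) : ℕ :=
  sInf ((fun a : ι → ℤ => ∑ i, g (c i - a i)) '' P)

/-- The point of the interval `[α, β]` that is nearest to `k`. -/
def clamp (α β k : ℤ) : ℤ := max α (min β k)

theorem sum_cost_move_le {g : ℤ → ℕ} {a a' c : ι → ℤ} {t j : ι} (htj : t ≠ j)
    (hoff : ∀ i, i ≠ t → i ≠ j → a' i = a i)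
    (hle : g (c t - a' t) + g (c j - a' j) ≤ g (c t - a t) + g (c j - a j)) :
    ∑ i, g (c i - a' i) ≤ ∑ i, g (c i - a i) := by
  rw [← Finset.sum_add_sum_compl {t, j}, ← Finset.sum_add_sum_compl {t, j} fun i => g (c i - a i),
    Finset.sum_pair htj, Finset.sum_pair htj]
  refine add_le_add hle (le_of_eq (Finset.sum_congr rfl fun i hi => ?_))
  simp only [Finset.mem_compl, Finset.mem_insert, Finset.mem_singleton, not_or] at hi
  rw [hoff i hi.1 hi.2]

/-- Exchanging towards a point with extremal `t`-coordinate moves `a t` one step towards the clamp;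
`c t - a t` moves towards zero, so the step cost cannot rise. -/
theorem IsExchange.exists_clamp {P : Set (ι → ℤ)} (hP : IsExchange P) {t : ι} {α β : ℤ}
    (hb : ∀ a ∈ P, α ≤ a t ∧ a t ≤ β) (hα : ∃ a ∈ P, a t = α) (hβ : ∃ a ∈ P, a t = β)
    {g : ℤ → ℕ} (hg : IsStepCost g) (c : ι → ℤ) (a : ι → ℤ) (ha : a ∈ P) :
    ∃ a' ∈ P, a' t = clamp α β (c t) ∧ ∑ i, g (c i - a' i) ≤ ∑ i, g (c i - a i) := by
  induction hn : (a t - clamp α β (c t)).natAbs generalizing a with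
  | zero => exact ⟨a, ha, by omega, le_rfl⟩
  | succ n ih =>
    have hab := hb a ha
    rcases lt_trichotomy (a t) (clamp α β (c t)) with h | h | h
    · obtain ⟨q, hq, hqt⟩ := hβ
      obtain ⟨j, hj, hm⟩ := hP.up a ha q hq t (by unfold clamp at h; omega)
      have htj : t ≠ j := by rintro rfl; unfold clamp at h; omega
      obtain ⟨a', ha', h1, h2⟩ := ih _ hm (by simp [htj]; omega)
      refine ⟨a', ha', h1, h2.trans (sum_cost_move_le htj (fun i hi hi' => ?_) ?_)⟩
      · simp [hi, hi']
      · have := hg.pos (c t - a t) (c j - a j) (by unfold clamp at h; omega)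
        simp only [Pi.add_apply, Pi.sub_apply, Pi.single_eq_same, Pi.single_eq_of_ne htj,
          Pi.single_eq_of_ne htj.symm]
        convert this using 3 <;> ring
    · omega
    · obtain ⟨q, hq, hqt⟩ := hα
      obtain ⟨j, hj, hm⟩ := hP.down a ha q hq t (by unfold clamp at h; omega)
      have htj : t ≠ j := by rintro rfl; unfold clamp at h; omega
      obtain ⟨a', ha', h1, h2⟩ := ih _ hm (by simp [htj]; omega)
      refine ⟨a', ha', h1, h2.trans (sum_cost_move_le htj (fun i hi hi' => ?_) ?_)⟩
      · simp [hi, hi']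
      · have := hg.neg (c t - a t) (c j - a j) (by unfold clamp at h; omega)
        simp only [Pi.add_apply, Pi.sub_apply, Pi.single_eq_same, Pi.single_eq_of_ne htj,
          Pi.single_eq_of_ne htj.symm]
        convert this using 3 <;> ring

theorem IsExchange.slice_nonempty {P : Set (ι → ℤ)} (hP : IsExchange P) {t : ι} {α β : ℤ}
    (hb : ∀ a ∈ P, α ≤ a t ∧ a t ≤ β) (hα : ∃ a ∈ P, a t = α) (hβ : ∃ a ∈ P, a t = β)
    {j : ℤ} (hj : j ∈ Finset.Icc α β) : (slice P t j).Nonempty := by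
  obtain ⟨a, ha, -⟩ := id hα
  obtain ⟨a', ha', h, -⟩ := hP.exists_clamp hb hα hβ isStepCost_toNat (fun _ => j) a ha
  rw [Finset.mem_Icc] at hj
  exact ⟨a', ha', by rw [h]; unfold clamp; omega⟩

theorem mem_projSlice_iff {ι : Type*} {P : Set (ι → ℤ)} {t : ι} {j : ℤ} {a : ι → ℤ}
    (hat : a t = j) :
    (fun i : {i // i ≠ t} => a i) ∈ projSlice P t j ↔ a ∈ P := by
  constructor
  · rintro ⟨b, ⟨hb, hbt⟩, hba⟩
    have : b = a := by
      ext i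
      by_cases hi : i = t
      · rw [hi, hbt, hat]
      · exact congrFun hba ⟨i, hi⟩
    rwa [← this]
  · exact fun ha => ⟨a, ⟨ha, hat⟩, rfl⟩

/-- Points of a slice agree at `t`, so an exchange between them never uses `t`. Working with
exchange avoids finding a rank function for the slice. -/
theorem IsExchange.projSlice {ι : Type*} [LinearOrder ι] {P : Set (ι → ℤ)}
    (hP : IsExchange P) (t : ι) (j : ℤ) :
    IsExchange (projSlice P t j) where
  down := by
    rintro _ ⟨a, ⟨ha, hat⟩, rfl⟩ _ ⟨b, ⟨hb, hbt⟩, rfl⟩ i hi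
    obtain ⟨k, hk, hm⟩ := hP.down a ha b hb i hi
    have hkt : k ≠ t := by rintro rfl; omega
    refine ⟨⟨k, hkt⟩, hk, ?_⟩
    rw [← mem_projSlice_iff (t := t) (j := j) (by simp [i.2.symm, hkt.symm, hat])] at hm
    convert hm using 1
    ext l
    simp [Pi.single_apply, Subtype.ext_iff]
  up := by
    rintro _ ⟨a, ⟨ha, hat⟩, rfl⟩ _ ⟨b, ⟨hb, hbt⟩, rfl⟩ i hi
    obtain ⟨k, hk, hm⟩ := hP.up a ha b hb i hi
    have hkt : k ≠ t := by rintro rfl; omega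
    refine ⟨⟨k, hkt⟩, hk, ?_⟩
    rw [← mem_projSlice_iff (t := t) (j := j) (by simp [i.2.symm, hkt.symm, hat])] at hm
    convert hm using 1
    ext l
    simp [Pi.single_apply, Subtype.ext_iff]

theorem IsExchange.dist_eq {P : Set (ι → ℤ)} (hP : IsExchange P) {t : ι} {α β : ℤ}
    (hb : ∀ a ∈ P, α ≤ a t ∧ a t ≤ β) (hα : ∃ a ∈ P, a t = α) (hβ : ∃ a ∈ P, a t = β)
    {g : ℤ → ℕ} (hg : IsStepCost g) (c : ι → ℤ) :
    dist g P c = g (c t - clamp α β (c t)) +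
      dist g (Polymatroid.projSlice P t (clamp α β (c t))) (fun i => c i) := by
  obtain ⟨p, hp, hpt⟩ := id hα
  have hsplit : ∀ a : ι → ℤ, ∑ i, g (c i - a i) =
      g (c t - a t) + ∑ i : {i // i ≠ t}, g (c i - a i) := fun a =>
    Fintype.sum_eq_add_sum_subtype_ne (fun i => g (c i - a i)) t
  apply le_antisymm
  -- The slice must be nonempty, since `sInf ∅ = 0` would be attained by no point.
  · obtain ⟨a, ha, hat, -⟩ := hP.exists_clamp hb hα hβ hg c p hp
    obtain ⟨_, ⟨a, ⟨ha, hat⟩, rfl⟩, hmin⟩ := Nat.sInf_mem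
      (s := (fun b : {i // i ≠ t} → ℤ => ∑ i : {i // i ≠ t}, g (c i - b i)) ''
        Polymatroid.projSlice P t (clamp α β (c t)))
      ⟨_, _, ⟨a, ⟨ha, hat⟩, rfl⟩, rfl⟩
    rw [dist, dist, ← hmin]
    refine Nat.sInf_le ⟨a, ha, ?_⟩
    rw [← hat]
    exact hsplit a
  · obtain ⟨a, ha, hmin⟩ := Nat.sInf_mem (s := (fun a : ι → ℤ => ∑ i, g (c i - a i)) '' P)
      ⟨_, p, hp, rfl⟩
    obtain ⟨a', ha', h1, h2⟩ := hP.exists_clamp hb hα hβ hg c a ha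
    have hmem : (fun i : {i // i ≠ t} => a' i) ∈
        Polymatroid.projSlice P t (clamp α β (c t)) := ⟨a', ⟨ha', h1⟩, rfl⟩
    refine le_trans ?_ (h2.trans hmin.le)
    rw [hsplit a', h1]
    exact Nat.add_le_add_left (Nat.sInf_le (Set.mem_image_of_mem _ hmem)) _

/-! ### The generating function -/

/-- The summand at `c` of the generating function of `P`. -/
noncomputable def distTerm (u v : ℝ) {ι : Type*} [Fintype ι] (P : Set (ι → ℤ)) (c : ι → ℤ) : ℝ :=
  u ^ dist Int.toNat P c * v ^ dist (fun z => (-z).toNat) P c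

/-- The contribution of a coordinate `k` which is nearest to the point `j` of `[α, β]`. -/
noncomputable def coordTerm (u v : ℝ) (α β j k : ℤ) : ℝ :=
  if clamp α β k = j then u ^ (k - j).toNat * v ^ (-(k - j)).toNat else 0

/-- The weight of an index which is internally active iff `p` and externally active iff `q`. -/
def weight {R : Type*} [CommRing R] (x y : R) (p q : Prop) [Decidable p] [Decidable q] : R :=
  if p then if q then x + y - 1 else x else if q then y else 1

theorem IsExchange.distTerm_eq {P : Set (ι → ℤ)} (hP : IsExchange P) {t : ι} {α β : ℤ}
    (hb : ∀ a ∈ P, α ≤ a t ∧ a t ≤ β) (hα : ∃ a ∈ P, a t = α) (hβ : ∃ a ∈ P, a t = β)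
    (u v : ℝ) (c : ι → ℤ) :
    distTerm u v P c = ∑ j ∈ Finset.Icc α β,
      coordTerm u v α β j (c t) * distTerm u v (Polymatroid.projSlice P t j) (fun i => c i) := by
  obtain ⟨p, hp, -⟩ := id hα
  have hmem : clamp α β (c t) ∈ Finset.Icc α β := by
    have := hb p hp
    rw [Finset.mem_Icc]
    unfold clamp
    omega
  rw [Finset.sum_eq_single_of_mem _ hmem]
  · simp only [distTerm, coordTerm, if_true]
    rw [hP.dist_eq hb hα hβ isStepCost_toNat, hP.dist_eq hb hα hβ isStepCost_toNat_neg]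
    ring
  · intro j _ hj
    simp [coordTerm, hj.symm]

theorem coordTerm_nonneg {u v : ℝ} (hu : 0 ≤ u) (hv : 0 ≤ v) (α β j k : ℤ) :
    0 ≤ coordTerm u v α β j k := by
  unfold coordTerm
  split_ifs <;> positivity

theorem distTerm_nonneg {ι : Type*} [Fintype ι] {u v : ℝ} (hu : 0 ≤ u) (hv : 0 ≤ v)
    {P : Set (ι → ℤ)} (c : ι → ℤ) :
    0 ≤ distTerm u v P c := by
  unfold distTerm
  positivity

/-- Only `j = β` collects all `k ≥ j`, and only `j = α` all `k ≤ j`. If `α = β = j`, the total is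
`1/(1-u) + v/(1-v) = x + y - 1`. -/
theorem hasSum_coordTerm {u v : ℝ} (hu : 0 < u) (hu' : u < 1) (hv : 0 < v) (hv' : v < 1)
    {α β j : ℤ} (hj : j ∈ Finset.Icc α β) :
    HasSum (coordTerm u v α β j) (weight (1 - v)⁻¹ (1 - u)⁻¹ (j = α) (j = β)) := by
  rw [Finset.mem_Icc] at hj
  rw [← (Equiv.addRight j).hasSum_iff]
  have hpos : HasSum (fun n : ℕ => coordTerm u v α β j (n + j))
      (if j = β then (1 - u)⁻¹ else 1) := by
    split_ifs with h
    · convert hasSum_geometric_of_lt_one hu.le hu' using 2 with n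
      have : clamp α β (n + j) = j := by unfold clamp; omega
      simp [coordTerm, this]
    · convert hasSum_ite_eq 0 (1 : ℝ) using 2 with n
      by_cases hn : n = 0
      · have : clamp α β j = j := by unfold clamp; omega
        simp [coordTerm, this, hn]
      · have : clamp α β (n + j) ≠ j := by unfold clamp; omega
        simp [coordTerm, this, hn]
  have hneg : HasSum (fun n : ℕ => coordTerm u v α β j (-(n + 1) + j))
      (if j = α then v * (1 - v)⁻¹ else 0) := by
    split_ifs with h
    · have : (fun n : ℕ => coordTerm u v α β j (-(n + 1) + j)) = fun n => v * v ^ n := by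
        funext n
        have : clamp α β (-(n + 1) + j) = j := by unfold clamp; omega
        have h1 : (-((n : ℤ) + 1) + j - j).toNat = 0 := by omega
        have h2 : (-(-((n : ℤ) + 1) + j - j)).toNat = n + 1 := by omega
        rw [coordTerm, if_pos this, h1, h2]
        ring
      rw [this]
      exact (hasSum_geometric_of_lt_one hv.le hv').mul_left v
    · have : (fun n : ℕ => coordTerm u v α β j (-(n + 1) + j)) = fun _ => 0 := by
        funext n
        have : clamp α β (-(n + 1) + j) ≠ j := by unfold clamp; omega
        rw [coordTerm, if_neg this]
      rw [this]
      exact hasSum_zero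
  have hsum := HasSum.of_nat_of_neg_add_one (f := coordTerm u v α β j ∘ Equiv.addRight j)
    (by simpa using hpos) (by simpa using hneg)
  have h1v : (1 - v) ≠ 0 := by linarith
  convert hsum using 1
  unfold weight
  split_ifs <;> field_simp <;> ring

theorem IsExchange.hasSum_distTerm {P : Set (ι → ℤ)} (hP : IsExchange P) {t : ι} {α β : ℤ}
    (hb : ∀ a ∈ P, α ≤ a t ∧ a t ≤ β) (hα : ∃ a ∈ P, a t = α) (hβ : ∃ a ∈ P, a t = β)
    {u v : ℝ} (hu : 0 < u) (hu' : u < 1) (hv : 0 < v) (hv' : v < 1) {S : ℤ → ℝ}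
    (hS : ∀ j ∈ Finset.Icc α β, HasSum (distTerm u v (Polymatroid.projSlice P t j)) (S j)) :
    HasSum (distTerm u v P)
      (∑ j ∈ Finset.Icc α β, weight (1 - v)⁻¹ (1 - u)⁻¹ (j = α) (j = β) * S j) := by
  rw [funext (hP.distTerm_eq hb hα hβ u v)]
  refine hasSum_sum fun j hj => ?_
  have h1 := hasSum_coordTerm hu hu' hv hv' hj
  have h2 := h1.mul (hS j hj) (h1.summable.mul_of_nonneg (hS j hj).summable
    (coordTerm_nonneg hu.le hv.le α β j) (distTerm_nonneg hu.le hv.le))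
  exact (Equiv.funSplitAt t ℤ).hasSum_iff.2 h2

/-! ### Activities and the largest index -/

open Classical in
/-- The summand of the Tutte polynomial at `a`, as a product over the ground set. -/
theorem tutte_summand_eq_prod {ι : Type*} [Fintype ι] {R : Type*} [CommRing R]
    (x y : R) (A B : Set ι) :
    x ^ (A \ B).ncard * y ^ (B \ A).ncard * (x + y - 1) ^ (A ∩ B).ncard =
      ∏ i, weight x y (i ∈ A) (i ∈ B) := by
  have h : ∀ (C : Set ι) (z : R), z ^ C.ncard = ∏ i, if i ∈ C then z else 1 := by
    intro C z
    rw [Finset.prod_ite, Finset.prod_const_one, mul_one, Finset.prod_const,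
      Set.ncard_eq_toFinset_card' C]
    congr 2
    ext i
    simp
  rw [h, h, h, ← Finset.prod_mul_distrib, ← Finset.prod_mul_distrib]
  refine Finset.prod_congr rfl fun i _ => ?_
  by_cases hA : i ∈ A <;> by_cases hB : i ∈ B <;> simp [weight, hA, hB]

/-- Activity of `i` tests only smaller indices, so the largest one is never tested. -/
theorem mem_intActive_projSlice_iff {ι : Type*} [LinearOrder ι] {P : Set (ι → ℤ)} {t : ι}
    (ht : ∀ i, i ≤ t) {a : ι → ℤ} {j : ℤ} (hat : a t = j) (i : {i // i ≠ t}) :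
    i ∈ intActive (projSlice P t j) (fun i => a i) ↔ (i : ι) ∈ intActive P a := by
  have key : ∀ k : {i // i ≠ t},
      ((fun i : {i // i ≠ t} => a i) - Pi.single i 1 + Pi.single k 1 ∈ projSlice P t j) ↔
        a - Pi.single (i : ι) 1 + Pi.single (k : ι) 1 ∈ P := by
    intro k
    rw [← mem_projSlice_iff (t := t) (j := j) (by simp [i.2.symm, k.2.symm, hat])]
    refine iff_of_eq (congrArg (· ∈ projSlice P t j) ?_)
    ext l
    simp [Pi.single_apply, Subtype.ext_iff]
  constructor
  · intro h k hk
    exact fun hm => h ⟨k, (hk.trans_le (ht i)).ne⟩ hk ((key _).2 hm)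
  · intro h k hk
    exact fun hm => h k hk ((key _).1 hm)

theorem mem_extActive_projSlice_iff {ι : Type*} [LinearOrder ι] {P : Set (ι → ℤ)} {t : ι}
    (ht : ∀ i, i ≤ t) {a : ι → ℤ} {j : ℤ} (hat : a t = j) (i : {i // i ≠ t}) :
    i ∈ extActive (projSlice P t j) (fun i => a i) ↔ (i : ι) ∈ extActive P a := by
  have key : ∀ k : {i // i ≠ t},
      ((fun i : {i // i ≠ t} => a i) + Pi.single i 1 - Pi.single k 1 ∈ projSlice P t j) ↔
        a + Pi.single (i : ι) 1 - Pi.single (k : ι) 1 ∈ P := by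
    intro k
    rw [← mem_projSlice_iff (t := t) (j := j) (by simp [i.2.symm, k.2.symm, hat])]
    refine iff_of_eq (congrArg (· ∈ projSlice P t j) ?_)
    ext l
    simp [Pi.single_apply, Subtype.ext_iff]
  constructor
  · intro h k hk
    exact fun hm => h ⟨k, (hk.trans_le (ht i)).ne⟩ hk ((key _).2 hm)
  · intro h k hk
    exact fun hm => h k hk ((key _).1 hm)

theorem IsExchange.top_mem_intActive_iff {ι : Type*} [LinearOrder ι] {P : Set (ι → ℤ)}
    (hP : IsExchange P) {t : ι} (ht : ∀ i, i ≤ t) {α : ℤ} (hb : ∀ a ∈ P, α ≤ a t)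
    (hα : ∃ a ∈ P, a t = α) {a : ι → ℤ}
    (ha : a ∈ P) : t ∈ intActive P a ↔ a t = α := by
  constructor
  · intro h
    by_contra hne
    obtain ⟨q, hq, hqt⟩ := hα
    have := hb a ha
    have hlt : q t < a t := by omega
    obtain ⟨k, hk, hm⟩ := hP.down a ha q hq t hlt
    have hkt : k ≠ t := by rintro rfl; omega
    exact h k (lt_of_le_of_ne (ht k) hkt) hm
  · intro h k hk hm
    have := hb _ hm
    simp [hk.ne'] at this
    omega

theorem IsExchange.top_mem_extActive_iff {ι : Type*} [LinearOrder ι] {P : Set (ι → ℤ)}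
    (hP : IsExchange P) {t : ι} (ht : ∀ i, i ≤ t) {β : ℤ} (hb : ∀ a ∈ P, a t ≤ β)
    (hβ : ∃ a ∈ P, a t = β) {a : ι → ℤ}
    (ha : a ∈ P) : t ∈ extActive P a ↔ a t = β := by
  constructor
  · intro h
    by_contra hne
    obtain ⟨q, hq, hqt⟩ := hβ
    have := hb a ha
    have hlt : a t < q t := by omega
    obtain ⟨k, hk, hm⟩ := hP.up a ha q hq t hlt
    have hkt : k ≠ t := by rintro rfl; omega
    exact h k (lt_of_le_of_ne (ht k) hkt) hm
  · intro h k hk hm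
    have := hb _ hm
    simp [hk.ne'] at this
    omega

open MvPolynomial in
/-- Deletion-contraction of the Tutte polynomial with respect to the largest index. -/
theorem IsExchange.tutte_eq_sum_of_top {P : Set (ι → ℤ)} (hP : IsExchange P) (hfin : P.Finite)
    {t : ι} (ht : ∀ i, i ≤ t) {α β : ℤ} (hb : ∀ a ∈ P, α ≤ a t ∧ a t ≤ β)
    (hα : ∃ a ∈ P, a t = α) (hβ : ∃ a ∈ P, a t = β) :
    tutte P = ∑ j ∈ Finset.Icc α β,
      weight (X 0) (X 1) (j = α) (j = β) * tutte (Polymatroid.projSlice P t j) := by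
  classical
  rw [tutte, finsum_mem_eq_finite_toFinset_sum _ hfin,
    ← Finset.sum_fiberwise_of_maps_to (g := fun a : ι → ℤ => a t) (t := Finset.Icc α β)
      fun a ha => Finset.mem_Icc.2 (hb a (hfin.mem_toFinset.1 ha))]
  refine Finset.sum_congr rfl fun j _ => ?_
  have hinj : Set.InjOn (fun (a : ι → ℤ) (i : {i // i ≠ t}) => a i) (slice P t j) := by
    rintro a ⟨_, hat⟩ b ⟨_, hbt⟩ hab
    ext i
    by_cases hi : i = t
    · rw [hi, hat, hbt]
    · exact congrFun hab ⟨i, hi⟩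
  have hsl : (slice P t j).Finite := hfin.subset fun _ h => h.1
  rw [tutte, Polymatroid.projSlice, finsum_mem_image hinj,
    finsum_mem_eq_finite_toFinset_sum _ hsl, Finset.mul_sum]
  refine Finset.sum_congr (by ext a; simp [slice]) fun a ha => ?_
  have haP : a ∈ slice P t j := by simpa [slice] using ha
  rw [tutte_summand_eq_prod, tutte_summand_eq_prod, Fintype.prod_eq_mul_prod_subtype_ne _ t]
  congr 1
  · have h1 := hP.top_mem_intActive_iff ht (fun a ha => (hb a ha).1) hα haP.1
    have h2 := hP.top_mem_extActive_iff ht (fun a ha => (hb a ha).2) hβ haP.1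
    rw [haP.2] at h1 h2
    simp only [weight, h1, h2]
  · refine Finset.prod_congr rfl fun i _ => ?_
    have h1 := mem_intActive_projSlice_iff (P := P) ht haP.2 i
    have h2 := mem_extActive_projSlice_iff (P := P) ht haP.2 i
    unfold Polymatroid.projSlice at h1 h2
    simp only [weight, h1, h2]

/-! ### Comparison and the recursion for any index -/

theorem map_weight {R S : Type*} [CommRing R] [CommRing S] (φ : R →+* S) (x y : R)
    (p q : Prop) [Decidable p] [Decidable q] :
    φ (weight x y p q) = weight (φ x) (φ y) p q := by
  unfold weight
  split_ifs <;> simp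

open MvPolynomial in
/-- The value of the Tutte polynomial is the sum of the generating function. -/
theorem IsExchange.hasSum_distTerm_aeval_tutte {ι : Type*} [Fintype ι] [LinearOrder ι]
    {P : Set (ι → ℤ)} (hP : IsExchange P)
    (hfin : P.Finite) (hne : P.Nonempty) {u v : ℝ} (hu : 0 < u) (hu' : u < 1) (hv : 0 < v)
    (hv' : v < 1) :
    HasSum (distTerm u v P) (aeval ![(1 - v)⁻¹, (1 - u)⁻¹] (tutte P)) := by
  induction hn : Fintype.card ι generalizing ι with
  | zero =>
    have : IsEmpty ι := Fintype.card_eq_zero_iff.1 hn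
    have hP1 : P = {default} := (Set.subsingleton_of_subsingleton).eq_singleton_of_mem
      (by obtain ⟨a, ha⟩ := hne; rwa [Subsingleton.elim default a])
    convert hasSum_unique (distTerm u v P) using 1
    subst hP1
    simp [tutte, distTerm, dist, Set.eq_empty_of_isEmpty]
  | succ n ih =>
    have : Nonempty ι := Fintype.card_pos_iff.1 (by omega)
    obtain ⟨t, ht⟩ := Finite.exists_max (id : ι → ι)
    -- Without a rank function, the extreme values of `a t` on `P` serve as `α` and `β`.
    obtain ⟨p, hp, hmin⟩ := hfin.exists_minimalFor (fun a => a t) P hne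
    obtain ⟨q, hq, hmax⟩ := hfin.exists_maximalFor (fun a => a t) P hne
    have hb : ∀ a ∈ P, p t ≤ a t ∧ a t ≤ q t := fun a ha =>
      ⟨(le_total (p t) (a t)).elim id (hmin ha), (le_total (a t) (q t)).elim id (hmax ha)⟩
    have hα : ∃ a ∈ P, a t = p t := ⟨p, hp, rfl⟩
    have hβ : ∃ a ∈ P, a t = q t := ⟨q, hq, rfl⟩
    have key := hP.hasSum_distTerm hb hα hβ hu hu' hv hv' fun j hj =>
      ih (hP.projSlice t j) ((hfin.subset fun _ h => h.1).image _)
        ((hP.slice_nonempty hb hα hβ hj).image _) (by simp [hn])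
    convert key using 1
    rw [hP.tutte_eq_sum_of_top hfin ht hb hα hβ, map_sum]
    refine Finset.sum_congr rfl fun j _ => ?_
    rw [map_mul, ← AlgHom.coe_toRingHom, map_weight]
    simp

open MvPolynomial in
/-- Two integral polynomials in two variables agree if they agree at all points with both
coordinates larger than one. -/
theorem eq_of_aeval_inv_one_sub {p q : MvPolynomial (Fin 2) ℤ}
    (h : ∀ u v : ℝ, 0 < u → u < 1 → 0 < v → v < 1 →
      aeval ![(1 - v)⁻¹, (1 - u)⁻¹] p = aeval ![(1 - v)⁻¹, (1 - u)⁻¹] q) : p = q := by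
  apply map_injective (Int.castRingHom ℝ) Int.cast_injective
  refine funext_set (fun _ => Set.Ioi (1 : ℝ)) (fun _ => Set.Ioi_infinite 1) fun x hx => ?_
  have h0 : 1 < x 0 := hx 0 trivial
  have h1 : 1 < x 1 := hx 1 trivial
  -- Inverts `x 0 = 1/(1-v)`, `x 1 = 1/(1-u)`.
  have := h (1 - (x 1)⁻¹) (1 - (x 0)⁻¹) (by simpa using inv_lt_one_of_one_lt₀ h1)
    (by simp; linarith) (by simpa using inv_lt_one_of_one_lt₀ h0) (by simp; linarith)
  have hx' : ![(x 0), (x 1)] = x := by ext i; fin_cases i <;> rfl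
  simpa [eval_map, aeval_def, hx'] using this

open MvPolynomial in
/-- Deletion-contraction of the Tutte polynomial with respect to an arbitrary index. -/
theorem IsExchange.tutte_eq_sum {P : Set (ι → ℤ)} (hP : IsExchange P) (hfin : P.Finite)
    {t : ι} {α β : ℤ} (hb : ∀ a ∈ P, α ≤ a t ∧ a t ≤ β)
    (hα : ∃ a ∈ P, a t = α) (hβ : ∃ a ∈ P, a t = β) :
    tutte P = ∑ j ∈ Finset.Icc α β,
      weight (X 0) (X 1) (j = α) (j = β) * tutte (Polymatroid.projSlice P t j) := by
  obtain ⟨p, hp, -⟩ := id hα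
  refine eq_of_aeval_inv_one_sub fun u v hu hu' hv hv' => ?_
  refine (hP.hasSum_distTerm_aeval_tutte hfin ⟨p, hp⟩ hu hu' hv hv').unique ?_
  convert hP.hasSum_distTerm hb hα hβ hu hu' hv hv' fun j hj =>
    (hP.projSlice t j).hasSum_distTerm_aeval_tutte ((hfin.subset fun _ h => h.1).image _)
      ((hP.slice_nonempty hb hα hβ hj).image _) hu hu' hv hv' using 1
  rw [map_sum]
  refine Finset.sum_congr rfl fun j _ => ?_
  rw [map_mul, ← AlgHom.coe_toRingHom, map_weight]
  simp

end Polymatroid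

theorem theorem3p5 (n : ℕ) (P : Set (Fin n → ℤ)) (f : Finset (Fin n) → ℤ)
    (hP : Polymatroid.IsPolymatroid P f) (t : Fin n)
    (ht : 0 < Polymatroid.beta f t - Polymatroid.alpha f t) :
    Polymatroid.tutte P =
      MvPolynomial.X 0 * Polymatroid.tutte (Polymatroid.projSlice P t (Polymatroid.alpha f t)) +
      MvPolynomial.X 1 * Polymatroid.tutte (Polymatroid.projSlice P t (Polymatroid.beta f t)) +
      ∑ j ∈ Finset.Ioo (Polymatroid.alpha f t) (Polymatroid.beta f t),
        Polymatroid.tutte (Polymatroid.projSlice P t j) := by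
  -- For empty `P` both sides vanish, so nonemptiness need not be proved.
  rcases P.eq_empty_or_nonempty with rfl | hne
  · simp [Polymatroid.tutte, Polymatroid.projSlice, Polymatroid.slice]
  have hlt : Polymatroid.alpha f t < Polymatroid.beta f t := by omega
  rw [hP.isExchange.tutte_eq_sum hP.finite (fun a ha => ⟨hP.alpha_le t ha, hP.le_beta t ha⟩)
    (hP.exists_eq_alpha hne t) (hP.exists_eq_beta hne t), ← Finset.Ioc_insert_left hlt.le,
    Finset.sum_insert (by simp), ← Finset.Ioo_insert_right hlt, Finset.sum_insert (by simp),
    ← add_assoc]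
  congr 1
  · simp [Polymatroid.weight, hlt.ne, hlt.ne']
  · refine Finset.sum_congr rfl fun j hj => ?_
    rw [Finset.mem_Ioo] at hj
    simp [Polymatroid.weight, hj.1.ne', hj.2.ne]
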